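/- Let $X$ be a locally compact non-compact Hausdorff space. Let $A=RC(X)$ be the Boolean algebra of regular closed subsets of $X$ (ordered by inclusion, with $0=\emptyset$, $1=X$, $F\vee G=F\cup G$, $F\wedge G=\mathrm{cl}(\mathrm{int}(F\cap G))$, $F^*=\mathrm{cl}(X\setminus F)$), let $\rho$ be the relation on $A$ given by $F\,\rho\,G\iff F\cap G\neq\emptyset$, and let $\mathbb{B}=CR(X)\subseteq A$ be the set of compact regular closed sets. For a relation $C$ on $A$ write $a\,(-C)\,b$ for "not $a\,C\,b$", and $a\ll_C b$ for $a\,(-C)\,b^*$. A relation $C$ on $A$ is a normal contact relation if (C1) $a\neq 0$ implies $a\,C\,a$; (C2) $a\,C\,b$ implies $a\ne 0$ and $b\neq 0$; (C3) $a\,C\,b$ implies $b\,C\,a$; (C4) $a\,C\,(b\vee c)$ iff $a\,C\,b$ or $a\,C\,c$; (C5) if $a\,(-C)\,b$ then $a\,(-C)\,c$ and $b\,(-C)\,c^*$ for some $c\in A$; (C6) if $a\neq 1$ then $b\,(-C)\,a$ for some $b\neq 0$. Let $\mathcal K_a(X)$ be the set of all normal contact relations $C$ on $A$ such that $\rho\subseteq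 C$ and such that, for all $a\in A$ and $b\in\mathbb{B}$, $a\,C\,b$ implies $a\,\rho\,b$. It is partially ordered by $C_1\preceq_c C_2\iff C_2\subseteq C_1$. Let $\mathcal K(X)$ be the set of Hausdorff compactifications $(Y,f)$ of $X$ up to equivalence, and let $\mu_c:\mathcal K(X)\to\mathcal K_a(X)$ be the map that sends $[(Y,f)]$ to the relation $F\,C\,G\iff \mathrm{cl}_Y(f(F))\cap\mathrm{cl}_Y(f(G))\neq\emptyset$. (a) The Alexandroff extension $C_\rho$ of $\rho$, defined by $a\,C_\rho\,b$ iff $a\,\rho\,b$ or ($a\notin\mathbb{B}$ and $b\notin\mathbb{B}$), belongs to $\mathcal K_a(X)$ and is the least element of $(\mathcal K_a(X),\preceq_c)$. If $(\alpha X,\alpha)$ is the one-point compactification of $X$, then $\mu_c([(\alpha X,\alpha)])=C_\rho$. (b) Let $\mathbb{D}$ be the set of dyadic numbers in $(0,1)$, and define $C_{\beta\rho}$ as follows: for $a,b\in A$, $a\,(-C_{\beta\rho})\,b$ iff there is a family $\{c_d\in A : d\in\mathbb{D}\}$ such that $a\ll_\rho c_d\ll_\rho b^*$ for all $d\in\mathbb{D}$,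 and $c_{d_1}\ll_\rho c_{d_2}$ for all $d_1,d_2\in\mathbb{D}$ with $d_1<d_2$. Then $C_{\beta\rho}$ belongs to $\mathcal K_a(X)$ and is the greatest element of $(\mathcal K_a(X),\preceq_c)$. If $(\beta X,\beta)$ is the Stone–Čech compactification of $X$, then $\mu_c([(\beta X,\beta)])=C_{\beta\rho}$. -/

import Mathlib

open Set Topology

universe u v

/-! ### Contact relations on Boolean algebras -/

/-- A contact relation on a Boolean algebra: axioms (C1)-(C4). -/
structure IsContactRel {B : Type v} [BooleanAlgebra B] (C : B → B → Prop) : Prop where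
  refl_of_ne_bot : ∀ a, a ≠ ⊥ → C a a
  ne_bot : ∀ a b, C a b → a ≠ ⊥ ∧ b ≠ ⊥
  symm : ∀ a b, C a b → C b a
  sup_iff : ∀ a b c, C a (b ⊔ c) ↔ C a b ∨ C a c

/-- A normal contact relation: a contact relation that also satisfies (C5) and (C6). -/
structure IsNormalContactRel {B : Type v} [BooleanAlgebra B] (C : B → B → Prop) : Prop
    extends IsContactRel C where
  interpolate : ∀ a b, ¬ C a b → ∃ c, ¬ C a c ∧ ¬ C b cᶜ
  exists_far : ∀ a, a ≠ ⊤ → ∃ b, b ≠ ⊥ ∧ ¬ C b a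

/-- Non-tangential inclusion `a ≪_C b`, that is, `a (-C) b*`. -/
def NonTang {B : Type v} [BooleanAlgebra B] (C : B → B → Prop) (a b : B) : Prop :=
  ¬ C a bᶜ

/-- The Alexandroff extension `C_ρ` of `ρ` with respect to the set `I` of bounded elements:
`a C_ρ b` iff `a ρ b` or neither `a` nor `b` is bounded. -/
def alexandroffExt {B : Type v} (ρ : B → B → Prop) (I : Set B) (a b : B) : Prop :=
  ρ a b ∨ (a ∉ I ∧ b ∉ I)

/-- The dyadic numbers of the open interval `(0, 1)`. -/
def DyadicUnit : Set ℝ :=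
  {d | 0 < d ∧ d < 1 ∧ ∃ k n : ℕ, d = (k : ℝ) / 2 ^ n}

/-- The relation `C_{βρ}`: `a (-C_{βρ}) b` iff there is a family `c_d` indexed by the dyadic
numbers of `(0, 1)` with `a ≪_ρ c_d ≪_ρ b*` for all `d` and `c_d ≪_ρ c_e` whenever `d < e`. -/
def dyadicExt {B : Type v} [BooleanAlgebra B] (ρ : B → B → Prop) (a b : B) : Prop :=
  ¬ ∃ c : DyadicUnit → B,
      (∀ d, NonTang ρ a (c d) ∧ NonTang ρ (c d) bᶜ) ∧
      (∀ d₁ d₂ : DyadicUnit, d₁ < d₂ → NonTang ρ (c d₁) (c d₂))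

/-- `ρ ⊆_I C`: the relation `C` is a normal contact relation that contains `ρ` (RC1), and
`a C b` with `b ∈ I` implies `a ρ b` (RC2). -/
structure IsNormalExtOver {B : Type v} [BooleanAlgebra B] (ρ : B → B → Prop) (I : Set B)
    (C : B → B → Prop) : Prop where
  normal : IsNormalContactRel C
  contains : ∀ a b, ρ a b → C a b
  agrees : ∀ a b, b ∈ I → C a b → ρ a b

/-! ### The standard local contact algebra of a topological space -/

/-- `RC(X)`: the regular closed subsets of `X`. -/
@[ext]
structure RC (X : Type u) [TopologicalSpace X] where
  carrier : Set X
  regular : closure (interior carrier) = carrier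

namespace RC

variable {X : Type u} [TopologicalSpace X]

theorem isClosed (F : RC X) : IsClosed F.carrier := by
  rw [← F.regular]; exact isClosed_closure

theorem regular_closure_of_isOpen {U : Set X} (hU : IsOpen U) :
    closure (interior (closure U)) = closure U := by
  apply subset_antisymm
  · exact closure_minimal interior_subset isClosed_closure
  · exact closure_mono (interior_maximal subset_closure hU)

/-- The regular closed set `cl U`, for `U` open. -/
def ofOpen (U : Set X) (hU : IsOpen U) : RC X := ⟨closure U, regular_closure_of_isOpen hU⟩

theorem union_regular (F G : RC X) :
    closure (interior (F.carrier ∪ G.carrier)) = F.carrier ∪ G.carrier := by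
  apply subset_antisymm
  · exact closure_minimal interior_subset (F.isClosed.union G.isClosed)
  · apply union_subset
    · conv_lhs => rw [← F.regular]
      exact closure_mono (interior_mono subset_union_left)
    · conv_lhs => rw [← G.regular]
      exact closure_mono (interior_mono subset_union_right)

/-- The Boolean algebra of regular closed sets: the order is inclusion, `F ∨ G = F ∪ G`,
`F ∧ G = cl (int (F ∩ G))`, `F* = cl (X \ F)`, `1 = X`, `0 = ∅`. -/
instance instBooleanAlgebra : BooleanAlgebra (RC X) where
  le F G := F.carrier ⊆ G.carrier
  le_refl _ := subset_rfl
  le_trans _ _ _ h₁ h₂ := h₁.trans h₂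
  le_antisymm _ _ h₁ h₂ := RC.ext (subset_antisymm h₁ h₂)
  sup F G := ⟨F.carrier ∪ G.carrier, union_regular F G⟩
  le_sup_left _ _ := subset_union_left
  le_sup_right _ _ := subset_union_right
  sup_le _ _ _ h₁ h₂ := union_subset h₁ h₂
  inf F G := ⟨closure (interior (F.carrier ∩ G.carrier)), regular_closure_of_isOpen isOpen_interior⟩
  inf_le_left F _ := closure_minimal (interior_subset.trans inter_subset_left) F.isClosed
  inf_le_right _ G := closure_minimal (interior_subset.trans inter_subset_right) G.isClosed
  le_inf F G H h₁ h₂ := by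
    change F.carrier ⊆ closure (interior (G.carrier ∩ H.carrier))
    rw [← F.regular]
    exact closure_mono (interior_mono (subset_inter h₁ h₂))
  le_sup_inf F G H := by
    change closure (interior ((F.carrier ∪ G.carrier) ∩ (F.carrier ∪ H.carrier))) ⊆
      F.carrier ∪ closure (interior (G.carrier ∩ H.carrier))
    apply closure_minimal _ (F.isClosed.union isClosed_closure)
    intro x hx
    by_cases hF : x ∈ F.carrier
    · exact Or.inl hF
    · refine Or.inr (subset_closure ?_)
      refine mem_interior.2 ⟨interior ((F.carrier ∪ G.carrier) ∩ (F.carrier ∪ H.carrier)) ∩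
        F.carrierᶜ, ?_, isOpen_interior.inter F.isClosed.isOpen_compl, hx, hF⟩
      rintro y ⟨hy, hyF⟩
      have hy' := interior_subset hy
      exact ⟨hy'.1.resolve_left hyF, hy'.2.resolve_left hyF⟩
  top := ⟨univ, by simp⟩
  bot := ⟨∅, by simp⟩
  compl F := ⟨closure F.carrierᶜ, regular_closure_of_isOpen F.isClosed.isOpen_compl⟩
  le_top _ := subset_univ _
  bot_le _ := empty_subset _
  inf_compl_le_bot F := by
    change closure (interior (F.carrier ∩ closure F.carrierᶜ)) ⊆ ∅
    rw [interior_inter, closure_compl, interior_compl, F.regular]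
    have : interior F.carrier ∩ F.carrierᶜ = ∅ :=
      subset_empty_iff.1 fun x hx => hx.2 (interior_subset hx.1)
    rw [this, closure_empty]
  top_le_sup_compl F := by
    change univ ⊆ F.carrier ∪ closure F.carrierᶜ
    intro x _
    by_cases h : x ∈ F.carrier
    · exact Or.inl h
    · exact Or.inr (subset_closure h)

theorem ne_bot_iff (F : RC X) : F ≠ ⊥ ↔ F.carrier.Nonempty := by
  rw [nonempty_iff_ne_empty]
  exact not_congr ⟨fun h => congrArg RC.carrier h, fun h => RC.ext h⟩

theorem ne_top_iff (F : RC X) : F ≠ ⊤ ↔ F.carrier ≠ univ :=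
  not_congr ⟨fun h => congrArg RC.carrier h, fun h => RC.ext h⟩

end RC

/-- The standard contact relation `ρ_X` on `RC(X)`: `F ρ_X G` iff `F ∩ G ≠ ∅`. -/
def stdContact (X : Type u) [TopologicalSpace X] (F G : RC X) : Prop :=
  (F.carrier ∩ G.carrier).Nonempty

/-- `CR(X)`: the compact regular closed subsets of `X`. -/
def CR (X : Type u) [TopologicalSpace X] : Set (RC X) :=
  {F | IsCompact F.carrier}

/-- `𝒦_a(X)`: the normal contact relations `C` on `RC(X)` with `ρ_X ⊆_{CR(X)} C`. -/
structure Ka (X : Type u) [TopologicalSpace X] where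
  rel : RC X → RC X → Prop
  isNormalExtOver : IsNormalExtOver (stdContact X) (CR X) rel

/-- The order `≼_c`: `C₁ ≼_c C₂` iff `C₂ ⊆ C₁`. -/
instance Ka.instPartialOrder (X : Type u) [TopologicalSpace X] : PartialOrder (Ka X) where
  le C₁ C₂ := ∀ F G, C₂.rel F G → C₁.rel F G
  le_refl _ _ _ h := h
  le_trans _ _ _ h₁ h₂ F G h := h₁ F G (h₂ F G h)
  le_antisymm C₁ C₂ h₁ h₂ := by
    cases C₁; cases C₂
    congr
    funext F G
    exact propext ⟨h₂ F G, h₁ F G⟩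

/-! ### Hausdorff compactifications -/

/-- A Hausdorff compactification `(Y, f)` of `X`: `Y` is compact Hausdorff and `f : X → Y` is a
homeomorphic embedding with dense image. -/
structure HausdorffCompactification (X : Type u) [TopologicalSpace X] where
  space : Type u
  [top : TopologicalSpace space]
  [compact : CompactSpace space]
  [t2 : T2Space space]
  map : X → space
  isDenseEmbedding : IsDenseEmbedding map

attribute [instance] HausdorffCompactification.top HausdorffCompactification.compact
  HausdorffCompactification.t2

namespace HausdorffCompactification

variable {X : Type u} [TopologicalSpace X]

/-- Equivalence of compactifications: a homeomorphism `h : Y₁ → Y₂` with `h ∘ f₁ = f₂`. -/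
instance instSetoid (X : Type u) [TopologicalSpace X] : Setoid (HausdorffCompactification X) where
  r K L := ∃ h : K.space ≃ₜ L.space, h ∘ K.map = L.map
  iseqv :=
    { refl := fun K => ⟨Homeomorph.refl _, rfl⟩
      symm := fun {K L} ⟨h, hh⟩ => ⟨h.symm, by rw [← hh]; funext x; simp⟩
      trans := fun {K L M} ⟨h, hh⟩ ⟨g, hg⟩ =>
        ⟨h.trans g, by rw [← hg, ← hh]; rfl⟩ }

/-- The relation that a compactification `(Y, f)` induces on `RC(X)`:
`F C G` iff `cl_Y f(F)` and `cl_Y f(G)` meet. -/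
def contact (K : HausdorffCompactification X) (F G : RC X) : Prop :=
  (closure (K.map '' F.carrier) ∩ closure (K.map '' G.carrier)).Nonempty

theorem preimage_closure_image (K : HausdorffCompactification X) (F : RC X) :
    K.map ⁻¹' closure (K.map '' F.carrier) = F.carrier := by
  rw [← K.isDenseEmbedding.isEmbedding.isInducing.closure_eq_preimage_closure_image,
    F.isClosed.closure_eq]

theorem closure_image_ofOpen_subset (K : HausdorffCompactification X) {U : Set K.space}
    (hU : IsOpen U) :
    closure (K.map ''
      (RC.ofOpen (K.map ⁻¹' U) (hU.preimage K.isDenseEmbedding.continuous)).carrier) ⊆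
        closure U := by
  apply closure_minimal _ isClosed_closure
  rw [image_subset_iff]
  exact K.isDenseEmbedding.continuous.closure_preimage_subset U

/-- The induced relation of a compactification belongs to `𝒦_a(X)`. -/
theorem contact_isNormalExtOver (K : HausdorffCompactification X) :
    IsNormalExtOver (stdContact X) (CR X) K.contact where
  normal :=
    { refl_of_ne_bot := by
        intro F hF
        obtain ⟨x, hx⟩ := (RC.ne_bot_iff F).1 hF
        exact ⟨K.map x, subset_closure (mem_image_of_mem _ hx),
          subset_closure (mem_image_of_mem _ hx)⟩
      ne_bot := by
        rintro F G ⟨y, hF, hG⟩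
        rw [RC.ne_bot_iff, RC.ne_bot_iff]
        exact ⟨image_nonempty.1 (closure_nonempty_iff.1 ⟨y, hF⟩),
          image_nonempty.1 (closure_nonempty_iff.1 ⟨y, hG⟩)⟩
      symm := by
        rintro F G ⟨y, hF, hG⟩
        exact ⟨y, hG, hF⟩
      sup_iff := by
        intro F G H
        change (closure (K.map '' F.carrier) ∩
          closure (K.map '' (G.carrier ∪ H.carrier))).Nonempty ↔ _
        rw [image_union, closure_union, inter_union_distrib_left, union_nonempty]
        rfl
      interpolate := by
        intro F G h
        have hd : Disjoint (closure (K.map '' G.carrier)) (closure (K.map '' F.carrier)) := by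
          rw [disjoint_iff_inter_eq_empty, inter_comm]
          exact not_nonempty_iff_eq_empty.1 h
        obtain ⟨U, hU, hGU, hUF⟩ := normal_exists_closure_subset isClosed_closure
          isClosed_closure.isOpen_compl hd.subset_compl_right
        refine ⟨RC.ofOpen (K.map ⁻¹' U) (hU.preimage K.isDenseEmbedding.continuous), ?_, ?_⟩
        · rintro ⟨y, hyF, hy⟩
          exact hUF (K.closure_image_ofOpen_subset hU hy) hyF
        · rintro ⟨y, hyG, hy⟩
          have hsub : closure (K.map '' closure (closure (K.map ⁻¹' U))ᶜ) ⊆ Uᶜ := by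
            apply closure_minimal _ hU.isClosed_compl
            rw [image_subset_iff]
            apply closure_minimal _ (hU.isClosed_compl.preimage K.isDenseEmbedding.continuous)
            exact compl_subset_compl.2 subset_closure
          exact hsub hy (hGU hyG)
      exists_far := by
        intro F hF
        obtain ⟨x, hx⟩ := (ne_univ_iff_exists_notMem _).1 ((RC.ne_top_iff F).1 hF)
        have hx' : K.map x ∉ closure (K.map '' F.carrier) := by
          intro h
          exact hx (by rw [← K.preimage_closure_image F]; exact h)
        obtain ⟨U, hU, hxU, hUF⟩ := normal_exists_closure_subset (isClosed_singleton (x := K.map x))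
          (isClosed_closure (s := K.map '' F.carrier)).isOpen_compl (singleton_subset_iff.2 hx')
        refine ⟨RC.ofOpen (K.map ⁻¹' U) (hU.preimage K.isDenseEmbedding.continuous), ?_, ?_⟩
        · rw [RC.ne_bot_iff]
          exact ⟨x, subset_closure (hxU rfl)⟩
        · rintro ⟨y, hy, hyF⟩
          exact hUF (K.closure_image_ofOpen_subset hU hy) hyF }
  contains := by
    rintro F G ⟨x, hF, hG⟩
    exact ⟨K.map x, subset_closure (mem_image_of_mem _ hF), subset_closure (mem_image_of_mem _ hG)⟩
  agrees := by
    rintro F G hG ⟨y, hyF, hyG⟩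
    have hcl : IsClosed (K.map '' G.carrier) :=
      (IsCompact.image hG K.isDenseEmbedding.continuous).isClosed
    rw [hcl.closure_eq] at hyG
    obtain ⟨x, hxG, rfl⟩ := hyG
    refine ⟨x, ?_, hxG⟩
    rw [← K.preimage_closure_image F]
    exact hyF

theorem contact_eq_of_equiv {K L : HausdorffCompactification X} (h : K ≈ L) :
    K.contact = L.contact := by
  obtain ⟨h, hh⟩ := h
  funext F G
  unfold contact
  rw [← hh, image_comp, image_comp, ← h.image_closure, ← h.image_closure,
    ← image_inter h.injective, image_nonempty]

/-- The one-point (Alexandroff) compactification `(αX, α)`. -/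
def onePoint (X : Type u) [TopologicalSpace X] [T2Space X] [LocallyCompactSpace X]
    [NoncompactSpace X] : HausdorffCompactification X where
  space := OnePoint X
  map := OnePoint.some
  isDenseEmbedding := OnePoint.isDenseEmbedding_coe

/-- The Stone-Čech compactification `(βX, β)`. -/
def stoneCech (X : Type u) [TopologicalSpace X] [T2Space X] [LocallyCompactSpace X] :
    HausdorffCompactification X where
  space := StoneCech X
  map := stoneCechUnit
  isDenseEmbedding :=
    haveI : T35Space X := OnePoint.isOpenEmbedding_coe.isEmbedding.t35Space
    isDenseEmbedding_stoneCechUnit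

end HausdorffCompactification

/-- `𝒦(X)`: the Hausdorff compactifications of `X` up to equivalence. -/
def KX (X : Type u) [TopologicalSpace X] : Type (u + 1) :=
  Quotient (HausdorffCompactification.instSetoid X)

/-- The class `[(Y, f)]` of a compactification. -/
def KX.mk {X : Type u} [TopologicalSpace X] (K : HausdorffCompactification X) : KX X :=
  Quotient.mk _ K

/-- The map `μ_c : 𝒦(X) → 𝒦_a(X)`: the class of `(Y, f)` goes to the relation on `RC(X)` given by
`F C G` iff `cl_Y f(F) ∩ cl_Y f(G) ≠ ∅`. -/
def muC {X : Type u} [TopologicalSpace X] : KX X → Ka X :=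
  Quotient.lift (fun K => ⟨K.contact, K.contact_isNormalExtOver⟩) fun _ _ h => by
    congr 1
    exact HausdorffCompactification.contact_eq_of_equiv h

/-!
Both halves compare the relation `K.contact` of a concrete compactification, which is already known
to lie in `𝒦_a(X)`, with an explicitly described relation on `RC(X)`.

For the one-point compactification, the closure of a closed set `F` acquires the point `∞` exactly
when `F` is not compact, which gives `C_ρ` (`contact_onePoint`). Every `C` in `𝒦_a(X)` agrees with
`ρ` as soon as one argument is compact, so `C ⊆ C_ρ`.

For the Stone-Čech compactification, everything goes through functional separation: `F` and `G` are
functionally separated if some continuous `f : X → [0, 1]` is `0` on `F` and `1` on `G`. An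
interpolation argument in the style of Urysohn's lemma (`exists_continuous_of_interpolative`) turns
a chain that can be refined indefinitely into such an `f`. It applies to `≪_C` for any `C` in
`𝒦_a(X)`, by (C5), and to the members of a dyadic family. Conversely, the sublevel sets of `f` form
a dyadic family, and `f` extends over `βX`, where it separates the closures of `F` and `G`. Hence
the complements of `C_{βρ}` and of the relation of `βX` both consist of the functionally separated
pairs (`not_dyadicExt_iff`, `not_contact_stoneCech_iff`), and the complement of any `C` in `𝒦_a(X)`
is contained in this set (`FunctionallySeparated.of_not_rel`).
-/

/-! ### Regular closed sets and non-tangential inclusion -/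

section NonTangential

variable {X : Type u} [TopologicalSpace X]

theorem nonTang_stdContact_iff (F G : RC X) :
    NonTang (stdContact X) F G ↔ F.carrier ⊆ interior G.carrier := by
  change ¬ (F.carrier ∩ closure G.carrierᶜ).Nonempty ↔ _
  rw [closure_compl, inter_compl_nonempty_iff, not_not]

theorem nonTang_stdContact_compl_iff (F G : RC X) :
    NonTang (stdContact X) F Gᶜ ↔ Disjoint F.carrier G.carrier := by
  unfold NonTang
  rw [compl_compl, stdContact, not_nonempty_iff_eq_empty, disjoint_iff_inter_eq_empty]

theorem IsNormalContactRel.exists_nonTang_between {B : Type v} [BooleanAlgebra B]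
    {C : B → B → Prop} (hC : IsNormalContactRel C) {a b : B} (h : NonTang C a b) :
    ∃ c, NonTang C a c ∧ NonTang C c b := by
  obtain ⟨c, hac, hbc⟩ := hC.interpolate _ _ h
  refine ⟨cᶜ, ?_, fun hcb => hbc (hC.symm _ _ hcb)⟩
  rwa [NonTang, compl_compl]

end NonTangential

/-! ### The one-point compactification -/

section OnePointCompactification

variable {X : Type u} [TopologicalSpace X]

theorem infty_mem_closure_image_coe_iff {s : Set X} (hs : IsClosed s) :
    OnePoint.infty ∈ closure ((↑) '' s : Set (OnePoint X)) ↔ ¬ IsCompact s := by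
  constructor
  · intro h hc
    rw [(OnePoint.isClosed_image_coe.2 ⟨hs, hc⟩).closure_eq] at h
    exact OnePoint.infty_notMem_image_coe h
  · intro hc
    by_contra h
    refine hc (OnePoint.isClosed_image_coe.1 (isClosed_of_closure_subset fun y hy => ?_)).2
    induction y using OnePoint.rec with
    | infty => exact absurd hy h
    | coe x =>
      refine mem_image_of_mem _ ?_
      rwa [← hs.closure_eq,
        OnePoint.isOpenEmbedding_coe.isInducing.closure_eq_preimage_closure_image]

theorem contact_onePoint [T2Space X] [LocallyCompactSpace X] [NoncompactSpace X] :
    (HausdorffCompactification.onePoint X).contact = alexandroffExt (stdContact X) (CR X) := by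
  set K := HausdorffCompactification.onePoint X
  funext F G
  refine propext ⟨?_, ?_⟩
  · rintro ⟨y, hyF, hyG⟩
    change OnePoint X at y
    induction y using OnePoint.rec with
    | infty =>
      exact Or.inr ⟨(infty_mem_closure_image_coe_iff F.isClosed).1 hyF,
        (infty_mem_closure_image_coe_iff G.isClosed).1 hyG⟩
    | coe x =>
      refine Or.inl ⟨x, ?_, ?_⟩
      · rw [← K.preimage_closure_image F]; exact hyF
      · rw [← K.preimage_closure_image G]; exact hyG
  · rintro (h | ⟨hF, hG⟩)
    · exact K.contact_isNormalExtOver.contains F G h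
    · exact ⟨OnePoint.infty, (infty_mem_closure_image_coe_iff F.isClosed).2 hF,
        (infty_mem_closure_image_coe_iff G.isClosed).2 hG⟩

theorem IsNormalExtOver.alexandroffExt_of_rel {B : Type v} [BooleanAlgebra B]
    {ρ C : B → B → Prop} {I : Set B} (hC : IsNormalExtOver ρ I C) (hρ : ∀ a b, ρ a b → ρ b a)
    {a b : B} (h : C a b) : alexandroffExt ρ I a b := by
  by_cases hb : b ∈ I
  · exact Or.inl (hC.agrees a b hb h)
  by_cases ha : a ∈ I
  · exact Or.inl (hρ _ _ (hC.agrees b a ha (hC.normal.symm _ _ h)))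
  · exact Or.inr ⟨ha, hb⟩

end OnePointCompactification

/-! ### Functional separation by interpolation -/

section FunctionalSeparation

variable {X : Type u} [TopologicalSpace X]

/-- Two sets are functionally separated (completely separated) if a continuous function with values
in `[0, 1]` is `0` on the first and `1` on the second. -/
def FunctionallySeparated (s t : Set X) : Prop :=
  ∃ f : C(X, ℝ), EqOn f 0 s ∧ EqOn f 1 t ∧ ∀ x, f x ∈ Icc (0 : ℝ) 1

theorem FunctionallySeparated.mono {s s' t t' : Set X} (h : FunctionallySeparated s t)
    (hs : s' ⊆ s) (ht : t' ⊆ t) : FunctionallySeparated s' t' := by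
  obtain ⟨f, hf0, hf1, hf⟩ := h
  exact ⟨f, hf0.mono hs, hf1.mono ht, hf⟩

/-- Urysohn's lemma for regular closed sets: an interpolative relation `R` stronger than
non-tangential inclusion provides the successive refinements from which the separating function
is built. -/
theorem exists_continuous_of_interpolative {R : RC X → RC X → Prop}
    (hsub : ∀ F G, R F G → F.carrier ⊆ interior G.carrier)
    (hint : ∀ F G, R F G → ∃ E, R F E ∧ R E G) {F G : RC X} (h : R F G) :
    FunctionallySeparated F.carrier (interior G.carrier)ᶜ := by
  -- Mathlib's construction works with a closed set inside an open one, so the regular closed set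
  -- on the right enters through its interior, whose closure recovers it.
  let c : Urysohns.CU fun s t : Set X =>
      ∃ F G : RC X, R F G ∧ s = F.carrier ∧ t = interior G.carrier :=
    { C := F.carrier
      U := interior G.carrier
      P_C_U := ⟨F, G, h, rfl, rfl⟩
      closed_C := F.isClosed
      open_U := isOpen_interior
      subset := hsub F G h
      hP := by
        rintro _ _ - ⟨F, G, h, rfl, rfl⟩ - -
        obtain ⟨E, hFE, hEG⟩ := hint F G h
        exact ⟨interior E.carrier, isOpen_interior, hsub _ _ hFE,
          E.regular.trans_subset (hsub _ _ hEG), ⟨F, E, hFE, rfl, rfl⟩,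
          ⟨E, G, hEG, E.regular, rfl⟩⟩ }
  exact ⟨⟨c.lim, c.continuous_lim⟩, c.lim_of_mem_C, c.lim_of_notMem_U, c.lim_mem_Icc⟩

/-- Elements far apart for a normal contact relation containing `ρ_X` are functionally separated:
by (C5), its non-tangential inclusion is interpolative. -/
theorem FunctionallySeparated.of_not_rel {C : RC X → RC X → Prop} (hC : IsNormalContactRel C)
    (hρ : ∀ F G, stdContact X F G → C F G) {F G : RC X} (h : ¬ C F G) :
    FunctionallySeparated F.carrier G.carrier := by
  have hFG : NonTang C F Gᶜ := by rwa [NonTang, compl_compl]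
  refine (exists_continuous_of_interpolative (R := NonTang C)
    (fun A B hAB => (nonTang_stdContact_iff A B).1 fun h => hAB (hρ _ _ h))
    (fun A B => hC.exists_nonTang_between) hFG).mono subset_rfl ?_
  have hG : interior Gᶜ.carrier ⊆ G.carrierᶜ := by
    change interior (closure G.carrierᶜ) ⊆ G.carrierᶜ
    rw [closure_compl, interior_compl, G.regular]
  exact subset_compl_comm.1 hG

end FunctionalSeparation

/-! ### Dyadic families -/

section Dyadic

variable {X : Type u} [TopologicalSpace X]

theorem DyadicUnit.exists_between {d e : DyadicUnit} (h : d < e) : ∃ m, d < m ∧ m < e := by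
  obtain ⟨d, hd0, hd1, k, n, hd⟩ := d
  obtain ⟨e, he0, he1, l, m, he⟩ := e
  replace h : d < e := h
  refine ⟨⟨(d + e) / 2, by linarith, by linarith, k * 2 ^ m + l * 2 ^ n, n + m + 1, ?_⟩, ?_, ?_⟩
  · rw [hd, he]
    push_cast
    field_simp
    ring
  · change d < (d + e) / 2
    linarith
  · change (d + e) / 2 < e
    linarith

theorem FunctionallySeparated.of_not_dyadicExt {F G : RC X}
    (h : ¬ dyadicExt (stdContact X) F G) : FunctionallySeparated F.carrier G.carrier := by
  obtain ⟨c, hc, hmono⟩ := not_not.1 h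
  let d : DyadicUnit := ⟨1 / 4, by norm_num, by norm_num, 1, 2, by norm_num⟩
  let e : DyadicUnit := ⟨1 / 2, by norm_num, by norm_num, 1, 1, by norm_num⟩
  have hde : d < e := by
    change (1 / 4 : ℝ) < 1 / 2
    norm_num
  refine (exists_continuous_of_interpolative
    (R := fun A B => ∃ d e, d < e ∧ A = c d ∧ B = c e) ?_ ?_ ⟨d, e, hde, rfl, rfl⟩).mono ?_ ?_
  · rintro _ _ ⟨d, e, hde, rfl, rfl⟩
    exact (nonTang_stdContact_iff _ _).1 (hmono d e hde)
  · rintro _ _ ⟨d, e, hde, rfl, rfl⟩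
    obtain ⟨m, hdm, hme⟩ := DyadicUnit.exists_between hde
    exact ⟨c m, ⟨d, m, hdm, rfl, rfl⟩, ⟨m, e, hme, rfl, rfl⟩⟩
  · exact ((nonTang_stdContact_iff _ _).1 (hc d).1).trans interior_subset
  · have := (nonTang_stdContact_compl_iff _ _).1 (hc e).2
    exact this.subset_compl_left.trans (compl_subset_compl.2 interior_subset)

theorem FunctionallySeparated.not_dyadicExt {F G : RC X}
    (h : FunctionallySeparated F.carrier G.carrier) : ¬ dyadicExt (stdContact X) F G := by
  obtain ⟨f, hf0, hf1, -⟩ := h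
  have hopen (d : ℝ) : IsOpen {x | f x < d} := isOpen_lt f.continuous continuous_const
  let c (d : DyadicUnit) : RC X := RC.ofOpen _ (hopen d)
  have hle (d : DyadicUnit) : (c d).carrier ⊆ {x | f x ≤ d} :=
    closure_lt_subset_le f.continuous continuous_const
  have hint (d : DyadicUnit) : {x | f x < d} ⊆ interior (c d).carrier :=
    interior_maximal subset_closure (hopen d)
  refine not_not.2 ⟨c, fun d => ⟨?_, ?_⟩, fun d e hde => ?_⟩
  · refine (nonTang_stdContact_iff _ _).2 fun x hx => hint d ?_
    change f x < d
    rw [hf0 hx]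
    exact d.2.1
  · refine (nonTang_stdContact_compl_iff _ _).2 (disjoint_left.2 fun x hx hxG => ?_)
    have hxd : f x ≤ d := hle d hx
    rw [hf1 hxG] at hxd
    exact hxd.not_gt d.2.2.1
  · refine (nonTang_stdContact_iff _ _).2 fun x hx => hint e ?_
    exact lt_of_le_of_lt (b := (d : ℝ)) (hle d hx) hde

theorem not_dyadicExt_iff (F G : RC X) :
    ¬ dyadicExt (stdContact X) F G ↔ FunctionallySeparated F.carrier G.carrier :=
  ⟨FunctionallySeparated.of_not_dyadicExt, FunctionallySeparated.not_dyadicExt⟩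

end Dyadic

/-! ### The Stone-Čech compactification -/

section StoneCechCompactification

variable {X : Type u} [TopologicalSpace X] [T2Space X] [LocallyCompactSpace X]

theorem not_contact_stoneCech_iff (F G : RC X) :
    ¬ (HausdorffCompactification.stoneCech X).contact F G ↔
      FunctionallySeparated F.carrier G.carrier := by
  set K := HausdorffCompactification.stoneCech X
  refine ⟨FunctionallySeparated.of_not_rel K.contact_isNormalExtOver.normal
    K.contact_isNormalExtOver.contains, ?_⟩
  rintro ⟨f, hf0, hf1, hf⟩ ⟨y, hyF, hyG⟩
  let g : X → Icc (0 : ℝ) 1 := fun x => ⟨f x, hf x⟩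
  have hg : Continuous g := f.continuous.subtype_mk hf
  have key {s : Set X} {a : Icc (0 : ℝ) 1} (hs : ∀ x ∈ s, g x = a)
      (hy : y ∈ closure (stoneCechUnit '' s)) : stoneCechExtend hg y = a := by
    refine closure_minimal ?_
      (isClosed_singleton.preimage (continuous_stoneCechExtend hg)) hy
    rintro _ ⟨x, hx, rfl⟩
    exact (stoneCechExtend_stoneCechUnit hg x).trans (hs x hx)
  have h0 : stoneCechExtend hg y = 0 := key (fun x hx => Subtype.ext (hf0 hx)) hyF
  have h1 : stoneCechExtend hg y = 1 := key (fun x hx => Subtype.ext (hf1 hx)) hyG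
  exact zero_ne_one (h0.symm.trans h1)

theorem contact_stoneCech :
    (HausdorffCompactification.stoneCech X).contact = dyadicExt (stdContact X) := by
  funext F G
  exact propext (not_iff_not.1 ((not_contact_stoneCech_iff F G).trans (not_dyadicExt_iff F G).symm))

end StoneCechCompactification

/-! ### The least and the greatest element of `𝒦_a(X)` -/

theorem mainTheorem8 (X : Type u) [TopologicalSpace X] [T2Space X] [LocallyCompactSpace X]
    [NoncompactSpace X] :
    (∃ Cα : Ka X,
      Cα.rel = alexandroffExt (stdContact X) (CR X) ∧
      (∀ C : Ka X, Cα ≤ C) ∧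
      muC (KX.mk (HausdorffCompactification.onePoint X)) = Cα) ∧
    (∃ Cβ : Ka X,
      Cβ.rel = dyadicExt (stdContact X) ∧
      (∀ C : Ka X, C ≤ Cβ) ∧
      muC (KX.mk (HausdorffCompactification.stoneCech X)) = Cβ) := by
  have hα : (muC (KX.mk (HausdorffCompactification.onePoint X))).rel =
      alexandroffExt (stdContact X) (CR X) := contact_onePoint
  have hβ : (muC (KX.mk (HausdorffCompactification.stoneCech X))).rel =
      dyadicExt (stdContact X) := contact_stoneCech
  refine ⟨⟨_, hα, fun C F G h => ?_, rfl⟩, ⟨_, hβ, fun C F G => ?_, rfl⟩⟩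
  · rw [hα]
    refine C.isNormalExtOver.alexandroffExt_of_rel (fun A B hAB => ?_) h
    rwa [stdContact, inter_comm]
  · rw [hβ]
    contrapose
    intro h
    exact (FunctionallySeparated.of_not_rel C.isNormalExtOver.normal
      C.isNormalExtOver.contains h).not_dyadicExt
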